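/- For $p\in\mathbb R^2$ let $D(p)$ be the open unit disc centered at $p$. A finite set $S\subset\mathbb R^2$ is a \emph{valid configuration} if $D(p)\cap D(q)=\emptyset$ for all distinct $p,q\in S$ (equivalently, distinct points of $S$ are at distance at least $2$). For a nonempty finite set $P\subset\mathbb R^2$ let $r(P)$ be the radius of the smallest closed disc enclosing $P$. For two valid configurations $S,T'$ of $n$ points each, the unlabeled single-translation problem $\mathrm{UST}(S,T')$ is \emph{feasible} if the points can be listed as $S=\{s_1,\dots,s_n\}$ and $T'=\{t_1,\dots,t_n\}$ so that, for each $i=1,\dots,n$, the open unit disc that is translated along the straight segment from $s_i$ to $t_i$ is at all times disjoint from the discs $D(s_j)$, $j>i$ (not yet moved), and from the discs $D(t_j)$, $j<i$ (already moved). \textbf{Theorem.} There is an absolute constant $C>0$ such that the following holds for every $n\ge 1$. Let $S$ and $T$ be two valid configurations of $n$ points each whose smallest enclosing discs have the same center. Then there is a translation $v\in\mathbb R^2$ such that $\mathrm{UST}(S,T+v)$ is feasible, $$|v|\le C\,(r(S)+r(T))\,n \qquad\text{and}\qquad r\bigl(S\cup(T+v)\bigr)\le C\,(r(S)+r(T))\,n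 .$$ -/

import Mathlib

/-- The Euclidean plane. -/
abbrev Plane : Type := EuclideanSpace ℝ (Fin 2)

/-- The open unit disc centered at `p`.  Discs are open, so that touching is allowed. -/
def unitDisc (p : Plane) : Set Plane := Metric.ball p 1

/-- A set of centers is a valid configuration if the open unit discs around any two distinct
points of it are disjoint. -/
def ValidConfiguration (S : Set Plane) : Prop :=
  S.Pairwise fun p q => Disjoint (unitDisc p) (unitDisc q)

/-- The translated configuration `T + v`. -/
def translateBy (T : Set Plane) (v : Plane) : Set Plane := (fun p => p + v) '' T

/-- Translating the unit disc along the straight segment from `a` to `b` never makes it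
collide with the stationary unit disc at `c`. -/
def MoveAvoids (a b c : Plane) : Prop :=
  ∀ τ ∈ Set.Icc (0 : ℝ) 1, Disjoint (unitDisc (AffineMap.lineMap a b τ)) (unitDisc c)

/-- The discs are moved once each, in the order `0, 1, …, n - 1`, the `i`-th move being the
straight translation from `s i` to `t i`.  Each move avoids the discs that have not moved yet
and the discs that have already been moved. -/
def IsValidItinerary {n : ℕ} (s t : Fin n → Plane) : Prop :=
  ∀ i, (∀ j, i < j → MoveAvoids (s i) (t i) (s j)) ∧
    (∀ j, j < i → MoveAvoids (s i) (t i) (t j))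

/-- The unlabeled single-translation problem from `S` to `T` is feasible: the points of `S` and
of `T` can be listed without repetition, which fixes both the matching and the order of the
moves, in such a way that the resulting itinerary is valid. -/
def USTFeasible (S T : Set Plane) : Prop :=
  ∃ (n : ℕ) (s t : Fin n → Plane),
    Function.Injective s ∧ Set.range s = S ∧
    Function.Injective t ∧ Set.range t = T ∧ IsValidItinerary s t

/-- The closed disc with center `c` and radius `r ≥ 0` is a smallest disc enclosing `P`. -/
def IsSmallestEnclosingDisc (P : Set Plane) (c : Plane) (r : ℝ) : Prop :=
  0 ≤ r ∧ P ⊆ Metric.closedBall c r ∧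
    ∀ (c' : Plane) (r' : ℝ), 0 ≤ r' → P ⊆ Metric.closedBall c' r' → r ≤ r'

/-! ### Separation of discs -/

/-! Push `T` far away along some `f = (1, x)`, by `D • f` with `D` of order `R * n`, `R = rS + rT`.
List both sets by decreasing inner product with `f` and match by rank. The common center makes each
displacement `D • f + a` with `‖a‖ ≤ R`. Unmoved discs then lie behind the moving one, and moved
discs lie ahead of its target. By `two_le_norm_smul_sub`, only a pair at distance below `4` and
nearly orthogonal to `f` could collide. Packing leaves at most `81 * n` close differences per set,
each spoiling at most one of the slopes `k / N`, so `N = 162 * n + 1` slopes suffice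
(`exists_slopeVector`). -/

theorem disjoint_unitDisc_iff {p q : Plane} :
    Disjoint (unitDisc p) (unitDisc q) ↔ 2 ≤ ‖p - q‖ := by
  rw [unitDisc, unitDisc, disjoint_ball_ball_iff one_pos one_pos, dist_eq_norm]
  norm_num

theorem ValidConfiguration.two_le_norm_sub {S : Set Plane} (hS : ValidConfiguration S)
    {p q : Plane} (hp : p ∈ S) (hq : q ∈ S) (hpq : p ≠ q) : 2 ≤ ‖p - q‖ :=
  disjoint_unitDisc_iff.1 (hS hp hq hpq)

/-- A point moving along the ray in direction `D • f + a` stays at distance at least `2` from an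
obstacle `w` lying behind it with respect to `f`, provided that the perturbation `a` is small and
that `w`, if close, is not nearly orthogonal to `f`. -/
theorem two_le_norm_smul_sub {E : Type*} [NormedAddCommGroup E] [InnerProductSpace ℝ E]
    {f a w : E} {D R τ : ℝ} (hw : 2 ≤ ‖w‖) (hτ : 0 ≤ τ) (ha : ‖a‖ ≤ R) (hf : 1 ≤ ‖f‖)
    (hD : 3 * R ≤ D) (hneg : inner ℝ f w ≤ 0)
    (hgap : ‖w‖ < 4 → R * ‖w‖ ≤ D * |inner ℝ f w|) :
    2 ≤ ‖τ • (D • f + a) - w‖ := by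
  have hR : 0 ≤ R := (norm_nonneg a).trans ha
  have haw : inner ℝ a w ≤ R * ‖w‖ := (real_inner_le_norm a w).trans (by gcongr)
  have hin : inner ℝ (D • f + a) w = D * inner ℝ f w + inner ℝ a w := by
    rw [inner_add_left, real_inner_smul_left]
  have hsq : ‖τ • (D • f + a) - w‖ ^ 2 =
      (τ * ‖D • f + a‖) ^ 2 - 2 * (τ * inner ℝ (D • f + a) w) + ‖w‖ ^ 2 := by
    rw [norm_sub_sq_real, norm_smul, real_inner_smul_left, Real.norm_of_nonneg hτ]
  refine le_of_sq_le_sq ?_ (norm_nonneg _)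
  rw [hsq]
  by_cases h4 : ‖w‖ < 4
  · have h1 := hgap h4
    rw [abs_of_nonpos hneg] at h1
    have h2 : τ * inner ℝ (D • f + a) w ≤ 0 :=
      mul_nonpos_of_nonneg_of_nonpos hτ (by rw [hin]; linarith)
    nlinarith [sq_nonneg (τ * ‖D • f + a‖)]
  -- For a far obstacle, the squared distance is at least `(2τR)² - 2τR‖w‖ + ‖w‖² ≥ 3‖w‖²/4 ≥ 12`.
  · have hd : 2 * R ≤ ‖D • f + a‖ := by
      have h1 : ‖D • f‖ - ‖a‖ ≤ ‖D • f + a‖ := by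
        simpa using norm_sub_norm_le (D • f) (-a)
      have h2 : D ≤ ‖D • f‖ := by
        rw [norm_smul, Real.norm_of_nonneg (by linarith)]
        nlinarith
      linarith
    have h1 : inner ℝ (D • f + a) w ≤ R * ‖w‖ := by
      rw [hin]
      nlinarith
    have h2 : τ * inner ℝ (D • f + a) w ≤ τ * (R * ‖w‖) := by gcongr
    have h3 : (τ * (2 * R)) ^ 2 ≤ (τ * ‖D • f + a‖) ^ 2 := by gcongr
    nlinarith [sq_nonneg (4 * (τ * R) - ‖w‖)]

/-! ### Packing -/

/-- The unit cell of the integer grid containing a point. -/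
noncomputable def gridCell (p : Plane) : ℤ × ℤ := (⌊p 0⌋, ⌊p 1⌋)

theorem Plane.norm_sq (p : Plane) : ‖p‖ ^ 2 = p 0 ^ 2 + p 1 ^ 2 := by
  simp [EuclideanSpace.norm_sq_eq, Fin.sum_univ_two]

theorem Plane.abs_apply_le_norm (p : Plane) (i : Fin 2) : |p i| ≤ ‖p‖ := by
  simpa using PiLp.norm_apply_le p i

/-- Two points of one unit cell are less than `√2 < 2` apart. -/
theorem gridCell_injOn {S : Set Plane} (hS : ValidConfiguration S) : Set.InjOn gridCell S := by
  intro p hp q hq h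
  by_contra hpq
  have h2 := hS.two_le_norm_sub hp hq hpq
  have hn := Plane.norm_sq (p - q)
  simp only [gridCell, Prod.mk.injEq] at h
  have h0 := abs_lt.1 (Int.abs_sub_lt_one_of_floor_eq_floor h.1)
  have h1 := abs_lt.1 (Int.abs_sub_lt_one_of_floor_eq_floor h.2)
  simp only [PiLp.sub_apply] at hn
  nlinarith

theorem floor_mem_Icc_of_abs_sub_lt {x y : ℝ} (h : |x - y| < 4) :
    ⌊y⌋ ∈ Finset.Icc (⌊x⌋ - 4) (⌊x⌋ + 4) := by
  rw [abs_lt] at h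
  rw [Finset.mem_Icc]
  constructor
  · rw [Int.le_floor]
    push_cast
    linarith [Int.floor_le x]
  · rw [← Int.lt_add_one_iff, Int.floor_lt]
    push_cast
    linarith [Int.lt_floor_add_one x]

open Classical in
/-- The differences of points of `S` at distance less than `4`. -/
noncomputable def closeDifferences (S : Finset Plane) : Finset Plane :=
  S.biUnion fun p => {q ∈ S | ‖p - q‖ < 4}.image (p - ·)

theorem sub_mem_closeDifferences {S : Finset Plane} {p q : Plane} (hp : p ∈ S) (hq : q ∈ S)
    (h : ‖p - q‖ < 4) : p - q ∈ closeDifferences S := by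
  classical
  simp only [closeDifferences, Finset.mem_biUnion, Finset.mem_image, Finset.mem_filter]
  exact ⟨p, hp, q, ⟨hq, h⟩, rfl⟩

theorem card_closeDifferences_le {S : Finset Plane} (hS : ValidConfiguration (S : Set Plane)) :
    (closeDifferences S).card ≤ S.card * 81 := by
  classical
  refine Finset.card_biUnion_le_card_mul _ _ _ fun p _ => Finset.card_image_le.trans ?_
  have hcard : (Finset.Icc (⌊p 0⌋ - 4) (⌊p 0⌋ + 4) ×ˢ
      Finset.Icc (⌊p 1⌋ - 4) (⌊p 1⌋ + 4)).card = 81 := by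
    simp only [Finset.card_product, Int.card_Icc]
    ring_nf
    rfl
  rw [← hcard]
  refine Finset.card_le_card_of_injOn gridCell ?_
    ((gridCell_injOn hS).mono fun q hq => (Finset.mem_filter.1 hq).1)
  intro q hq
  obtain ⟨-, h⟩ := Finset.mem_filter.1 hq
  refine Finset.mem_product.2 ⟨floor_mem_Icc_of_abs_sub_lt ?_, floor_mem_Icc_of_abs_sub_lt ?_⟩
  · exact (Plane.abs_apply_le_norm (p - q) 0).trans_lt h
  · exact (Plane.abs_apply_le_norm (p - q) 1).trans_lt h

/-! ### Choice of a direction -/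

/-- The direction of slope `x`. -/
def slopeVector (x : ℝ) : Plane := !₂[1, x]

theorem inner_slopeVector (x : ℝ) (w : Plane) : inner ℝ (slopeVector x) w = w 0 + w 1 * x := by
  simp [slopeVector, PiLp.inner_apply, Fin.sum_univ_two]

theorem one_le_norm_slopeVector (x : ℝ) : 1 ≤ ‖slopeVector x‖ := by
  simpa [slopeVector] using Plane.abs_apply_le_norm (slopeVector x) 0

theorem norm_slopeVector_le {x : ℝ} (h0 : 0 ≤ x) (h1 : x ≤ 1) : ‖slopeVector x‖ ≤ 2 := by
  refine le_of_sq_le_sq ?_ zero_le_two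
  rw [Plane.norm_sq]
  simp only [slopeVector, PiLp.toLp_apply, Matrix.cons_val_zero, Matrix.cons_val_one]
  nlinarith

/-- A nonzero vector is nearly orthogonal to at most one of the directions of slope `k / N`. -/
theorem eq_of_abs_inner_slopeVector_lt {N k l : ℕ} (hk : k < N) (hl : l < N) {w : Plane}
    (hkw : 8 * N * |inner ℝ (slopeVector (k / N)) w| < ‖w‖)
    (hlw : 8 * N * |inner ℝ (slopeVector (l / N)) w| < ‖w‖) : k = l := by
  wlog hkl : k < l generalizing k l
  · rcases lt_trichotomy k l with h | h | h
    · exact this hk hl hkw hlw h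
    · exact h
    · exact (this hl hk hlw hkw h).symm
  exfalso
  have hN : (0 : ℝ) < N := by exact_mod_cast (Nat.zero_le k).trans_lt hk
  have hN1 : (1 : ℝ) ≤ N := by exact_mod_cast (Nat.zero_le k).trans_lt hk
  have hkl' : (k : ℝ) + 1 ≤ l := by exact_mod_cast hkl
  have hkN : (k : ℝ) ≤ N := by exact_mod_cast hk.le
  have hk0 : (0 : ℝ) ≤ k := Nat.cast_nonneg k
  have scale (m : ℕ) (h : 8 * N * |inner ℝ (slopeVector (m / N)) w| < ‖w‖) :
      8 * |N * w 0 + w 1 * m| < ‖w‖ := by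
    rw [inner_slopeVector, mul_assoc, ← abs_of_pos hN, ← abs_mul, abs_of_pos hN] at h
    rwa [show (N : ℝ) * (w 0 + w 1 * (m / N)) = N * w 0 + w 1 * m by field_simp] at h
  have h1 := scale k hkw
  have h2 := scale l hlw
  -- Subtracting the two bounds isolates `w 1 * (l - k)`, and `l - k ≥ 1`. With `hw0` this gives
  -- `‖w‖² < (9/64 + 1/16)‖w‖²`, which is absurd.
  have hw1 : 4 * |w 1| < ‖w‖ := by
    have h3 : |w 1 * (l - k)| ≤ |N * w 0 + w 1 * l| + |N * w 0 + w 1 * k| := by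
      rw [show w 1 * ((l : ℝ) - k) = (N * w 0 + w 1 * l) - (N * w 0 + w 1 * k) by ring]
      exact abs_sub _ _
    rw [abs_mul, abs_of_nonneg (by linarith : (0 : ℝ) ≤ l - k)] at h3
    nlinarith [abs_nonneg (w 1)]
  have hw0 : 8 * |w 0| < 3 * ‖w‖ := by
    have h3 : |N * w 0| ≤ |N * w 0 + w 1 * k| + |w 1 * k| := by
      rw [show (N : ℝ) * w 0 = (N * w 0 + w 1 * k) - w 1 * k by ring]
      simpa using abs_sub (N * w 0 + w 1 * k) (w 1 * k)
    rw [abs_mul, abs_mul, abs_of_pos hN, abs_of_nonneg hk0] at h3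
    have h4 : |w 1| * k ≤ |w 1| * N := by gcongr
    have h5 : N * (8 * |w 0|) < N * (3 * ‖w‖) := by
      nlinarith [norm_nonneg w]
    exact lt_of_mul_lt_mul_left h5 hN.le
  have hn := Plane.norm_sq w
  rw [← sq_abs (w 0), ← sq_abs (w 1)] at hn
  nlinarith [abs_nonneg (w 0), abs_nonneg (w 1), norm_nonneg w]

/-- Some direction is far from orthogonal to every vector of a given finite set. -/
theorem exists_slopeVector {N : ℕ} {W : Finset Plane} (hN : W.card < N) :
    ∃ x : ℝ, 0 ≤ x ∧ x ≤ 1 ∧ ∀ w ∈ W, ‖w‖ ≤ 8 * N * |inner ℝ (slopeVector x) w| := by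
  by_contra! hcon
  have hbad : ∀ k ∈ Finset.range N,
      ∃ w ∈ W, 8 * N * |inner ℝ (slopeVector ((k : ℕ) / N)) w| < ‖w‖ := by
    intro k hk
    have hkN : (k : ℝ) ≤ N := by exact_mod_cast (Finset.mem_range.1 hk).le
    exact hcon _ (by positivity) (div_le_one_of_le₀ hkN (by positivity))
  choose! g hgW hg using hbad
  obtain ⟨k, hk, l, hl, hkl, h⟩ := Finset.exists_ne_map_eq_of_card_lt_of_maps_to
    (by simpa using hN) hgW
  exact hkl (eq_of_abs_inner_slopeVector_lt (Finset.mem_range.1 hk) (Finset.mem_range.1 hl)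
    (hg k hk) (h ▸ hg l hl))

/-! ### Enumerations and enclosing discs -/

theorem exists_antitone_enumeration {α : Type*} {n : ℕ} (S : Finset α) (hS : S.card = n)
    (g : α → ℝ) :
    ∃ s : Fin n → α, Function.Injective s ∧ Set.range s = S ∧ Antitone (g ∘ s) := by
  let e := (S.equivFinOfCardEq hS).symm
  let h : Fin n → ℝ := fun i => -g (e i)
  refine ⟨fun i => e (Tuple.sort h i), ?_, ?_, ?_⟩
  · exact Subtype.val_injective.comp (e.injective.comp (Tuple.sort h).injective)
  · rw [show (fun i => (e (Tuple.sort h i) : α)) = Subtype.val ∘ ((Tuple.sort h).trans e) from rfl,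
      Set.range_comp, Equiv.range_eq_univ]
    simp
  · intro i j hij
    exact neg_le_neg_iff.1 (Tuple.monotone_sort h hij)

/-- The largest distance from `c` to `P` is continuous and coercive in `c`, so it attains its
minimum. -/
theorem exists_isSmallestEnclosingDisc {P : Set Plane} (hP : P.Finite) (hne : P.Nonempty) :
    ∃ c r, IsSmallestEnclosingDisc P c r := by
  lift P to Finset Plane using hP
  have hne' : P.Nonempty := hne
  let F : Plane → ℝ := fun c => P.sup' hne' fun p => dist p c
  have hF : Continuous F :=
    Continuous.finset_sup'_apply hne' fun p _ => continuous_const.dist continuous_id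
  obtain ⟨p, hp⟩ := hne'
  have hlim : Filter.Tendsto F (Filter.cocompact Plane) Filter.atTop :=
    Filter.tendsto_atTop_mono (fun c => Finset.le_sup' (fun p => dist p c) hp)
      (tendsto_dist_left_cocompact_atTop p)
  obtain ⟨c, hc⟩ := hF.exists_forall_le hlim
  refine ⟨c, F c, ?_, ?_, ?_⟩
  · exact dist_nonneg.trans (Finset.le_sup' (fun p => dist p c) hp)
  · exact fun q hq => Metric.mem_closedBall.2 (Finset.le_sup' (fun p => dist p c) hq)
  · exact fun c' r' _ h => (hc c').trans (Finset.sup'_le _ _ fun q hq => h hq)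

/-! ### The main theorem -/

theorem USTFeasible.of_slopeVector {n : ℕ} {S T : Finset Plane} {D R x : ℝ}
    (hSn : S.card = n) (hTn : T.card = n)
    (hS : ValidConfiguration (S : Set Plane)) (hT : ValidConfiguration (T : Set Plane))
    (hR : ∀ p ∈ S, ∀ q ∈ T, ‖q - p‖ ≤ R) (hD : 3 * R ≤ D)
    (hxS : ∀ w ∈ closeDifferences S, R * ‖w‖ ≤ D * |inner ℝ (slopeVector x) w|)
    (hxT : ∀ w ∈ closeDifferences T, R * ‖w‖ ≤ D * |inner ℝ (slopeVector x) w|) :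
    USTFeasible (S : Set Plane) (translateBy (T : Set Plane) (D • slopeVector x)) := by
  set f := slopeVector x
  obtain ⟨s, hs, hsS, hsf⟩ := exists_antitone_enumeration S hSn fun p => inner ℝ f p
  obtain ⟨t, ht, htT, htf⟩ := exists_antitone_enumeration T hTn fun p => inner ℝ f p
  have hsm (i) : s i ∈ S := by
    rw [← Finset.mem_coe, ← hsS]
    exact Set.mem_range_self i
  have htm (i) : t i ∈ T := by
    rw [← Finset.mem_coe, ← htT]
    exact Set.mem_range_self i
  refine ⟨n, s, fun i => t i + D • f, hs, hsS, (add_left_injective _).comp ht, ?_, ?_⟩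
  · rw [translateBy, ← htT, ← Set.range_comp]
    rfl
  have ha (i) := hR (s i) (hsm i) (t i) (htm i)
  have h1 := one_le_norm_slopeVector x
  refine fun i => ⟨fun j hij τ hτ => ?_, fun j hji τ hτ => ?_⟩
  · rw [disjoint_unitDisc_iff]
    have hne : s j ≠ s i := hs.ne hij.ne'
    have := two_le_norm_smul_sub (τ := τ) (w := s j - s i)
      (hS.two_le_norm_sub (hsm j) (hsm i) hne) hτ.1 (ha i) h1 hD
      (by rw [inner_sub_right]; exact sub_nonpos.2 (hsf hij.le))
      (fun h => hxS _ (sub_mem_closeDifferences (hsm j) (hsm i) h))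
    refine this.trans_eq (congrArg norm ?_)
    rw [AffineMap.lineMap_apply_module']
    module
  · rw [disjoint_unitDisc_iff]
    have hne : t i ≠ t j := ht.ne hji.ne'
    -- Time is reversed: seen from its target, the disc retreats along `-(D • f + a)`, away from the
    -- placed discs ahead.
    have := two_le_norm_smul_sub (τ := 1 - τ) (w := t i - t j)
      (hT.two_le_norm_sub (htm i) (htm j) hne) (sub_nonneg.2 hτ.2) (ha i) h1 hD
      (by rw [inner_sub_right]; exact sub_nonpos.2 (htf hji.le))
      (fun h => hxT _ (sub_mem_closeDifferences (htm i) (htm j) h))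
    rw [← norm_neg] at this
    refine this.trans_eq (congrArg norm ?_)
    rw [AffineMap.lineMap_apply_module']
    module

theorem mainTheorem6 :
    ∃ C : ℝ, 0 < C ∧
      ∀ (n : ℕ) (S T : Finset Plane) (c : Plane) (rS rT : ℝ),
        S.card = n → T.card = n →
        ValidConfiguration (S : Set Plane) → ValidConfiguration (T : Set Plane) →
        IsSmallestEnclosingDisc (S : Set Plane) c rS →
        IsSmallestEnclosingDisc (T : Set Plane) c rT →
        ∃ v : Plane,
          USTFeasible (S : Set Plane) (translateBy (T : Set Plane) v) ∧
          ‖v‖ ≤ C * ((rS + rT) * n) ∧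
          ∃ (c' : Plane) (r' : ℝ),
            IsSmallestEnclosingDisc ((S : Set Plane) ∪ translateBy (T : Set Plane) v) c' r' ∧
            r' ≤ C * ((rS + rT) * n) := by
  classical
  -- `D ≤ 8 * 163 * R * n` and `‖f‖ ≤ 2` give `2608`; the enclosing radius costs one more `R ≤ R *
  -- n`.
  refine ⟨2609, by norm_num, ?_⟩
  intro n S T c rS rT hSn hTn hS hT ⟨hrS, hSc, _⟩ ⟨hrT, hTc, _⟩
  rcases Nat.eq_zero_or_pos n with rfl | hn
  · obtain rfl := Finset.card_eq_zero.1 hSn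
    obtain rfl := Finset.card_eq_zero.1 hTn
    refine ⟨0, ⟨0, Fin.elim0, Fin.elim0, fun i => i.elim0, by simp, fun i => i.elim0,
      by simp [translateBy], fun i => i.elim0⟩, by simp, 0, 0, ⟨le_rfl, ?_, fun _ _ h _ => h⟩,
      by simp⟩
    simp [translateBy]
  set R := rS + rT
  have hR0 : 0 ≤ R := add_nonneg hrS hrT
  have hn1 : (1 : ℝ) ≤ n := by exact_mod_cast hn
  have hR : ∀ p ∈ S, ∀ q ∈ T, ‖q - p‖ ≤ R := by
    intro p hp q hq
    have h1 : dist p c ≤ rS := hSc hp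
    have h2 : dist q c ≤ rT := hTc hq
    rw [← dist_eq_norm]
    linarith [dist_triangle_right q p c]
  have hcard : (closeDifferences S ∪ closeDifferences T).card < 162 * n + 1 := by
    have h1 := card_closeDifferences_le hS
    have h2 := card_closeDifferences_le hT
    have h3 := Finset.card_union_le (closeDifferences S) (closeDifferences T)
    omega
  obtain ⟨x, hx0, hx1, hx⟩ := exists_slopeVector hcard
  push_cast at hx
  -- The factor `8 * N` turns `hx`, multiplied by `R`, into the gap condition.
  set D := R * (8 * (162 * n + 1)) with hDdef
  have hRn : R ≤ R * n := le_mul_of_one_le_right hR0 hn1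
  have hD3 : 3 * R ≤ D := by linarith
  have hx' (w) (hw : w ∈ closeDifferences S ∪ closeDifferences T) :
      R * ‖w‖ ≤ D * |inner ℝ (slopeVector x) w| := by
    rw [hDdef, mul_assoc]
    exact mul_le_mul_of_nonneg_left (hx w hw) hR0
  have hv : ‖D • slopeVector x‖ ≤ 2608 * (R * n) := by
    have h2 := norm_slopeVector_le hx0 hx1
    have hD0 : 0 ≤ D := by linarith
    rw [norm_smul, Real.norm_of_nonneg hD0]
    calc D * ‖slopeVector x‖ ≤ D * 2 := by gcongr
      _ ≤ 2608 * (R * n) := by linarith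
  refine ⟨D • slopeVector x, USTFeasible.of_slopeVector hSn hTn hS hT hR hD3
    (fun w hw => hx' w (Finset.mem_union_left _ hw))
    (fun w hw => hx' w (Finset.mem_union_right _ hw)), by linarith, ?_⟩
  have hSne : (S : Set Plane).Nonempty := Finset.coe_nonempty.2 (Finset.card_pos.1 (hSn ▸ hn))
  obtain ⟨c', r', h⟩ := exists_isSmallestEnclosingDisc
    (S.finite_toSet.union (T.finite_toSet.image (· + D • slopeVector x))) hSne.inl
  refine ⟨c', r', h, ?_⟩
  have hle : r' ≤ R + ‖D • slopeVector x‖ := by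
    refine h.2.2 c _ (by positivity) (Set.union_subset ?_ ?_)
    · intro p hp
      have h1 : dist p c ≤ rS := hSc hp
      exact Metric.mem_closedBall.2 (by linarith [norm_nonneg (D • slopeVector x)])
    · rintro _ ⟨q, hq, rfl⟩
      have h1 : dist q c ≤ rT := hTc hq
      refine Metric.mem_closedBall.2 ?_
      have h2 := dist_triangle (q + D • slopeVector x) q c
      rw [dist_self_add_left] at h2
      linarith
  linarith
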